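/- A non-horizontal line $\ell(t)=(a,b,0)+t(c,d,1)$, $t\in\mathbb C$, in $\mathbb C^3$ is represented by the point $(a,b,c,d)\in\mathbb C^4$, so that a point $x\in\mathbb C^{4n}=(\mathbb C^4)^n$ represents an $n$-tuple $L(x)=(\ell_1,\dots,\ell_n)$ of such lines. The intersection graph $G_{L(x)}$ has vertex set $[n]=\{1,\dots,n\}$, and distinct $i,j$ are adjacent if and only if $\ell_i$ and $\ell_j$ intersect, are parallel, or coincide. For a graph $G=([n],E)$ let $X_G\subset\mathbb C^{4n}$ be the Zariski closure of the set of all $x\in\mathbb C^{4n}$ such that the lines of $L(x)$ are pairwise distinct and every edge of $G$ is an edge of $G_{L(x)}$. The graph $G=(V,E)$ is called a Laman graph if $|E|=2|V|-3$ and every subgraph $G'=(V',E')$ of $G$ with $|V'|\ge 2$ satisfies $|E'|\le 2|V'|-3$. Theorem. If $G$ is a Laman graph on the vertex set $[n]$, then the variety $X_G$ has dimension exactly $2n+3$. -/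

import Mathlib

namespace LineConfig

/-- The non-horizontal line `t ↦ (a, b, 0) + t (c, d, 1)` in `ℂ³` that is represented by the point
`u = (a, b, c, d)` of `ℂ⁴`. -/
noncomputable def line (u : Fin 4 → ℂ) : AffineSubspace ℂ (Fin 3 → ℂ) :=
  AffineSubspace.mk' ![u 0, u 1, 0] (Submodule.span ℂ {![u 2, u 3, 1]})

theorem mem_line_iff (u : Fin 4 → ℂ) (p : Fin 3 → ℂ) :
    p ∈ line u ↔ ∃ t : ℂ, p = ![u 0, u 1, 0] + t • ![u 2, u 3, 1] := by
  rw [line, AffineSubspace.mem_mk', Submodule.mem_span_singleton]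
  refine exists_congr fun t => ?_
  rw [vsub_eq_sub, eq_sub_iff_add_eq, add_comm, eq_comm]

/-- The `n`-tuple of lines `L(x)` encoded by a point `x` of `ℂ^(4n)`; the four coordinates
`x (i, 0), …, x (i, 3)` are the parameters `a, b, c, d` of the `i`-th line. -/
noncomputable def lines {n : ℕ} (x : Fin n × Fin 4 → ℂ) (i : Fin n) :
    AffineSubspace ℂ (Fin 3 → ℂ) :=
  line fun k => x (i, k)

/-- The intersection graph of a tuple of lines: two different indices are adjacent if and only if
the corresponding lines have a common point or are parallel (equal lines are parallel). -/
def intersectionGraph {n : ℕ} (L : Fin n → AffineSubspace ℂ (Fin 3 → ℂ)) :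
    SimpleGraph (Fin n) where
  Adj i j := i ≠ j ∧ ((∃ p, p ∈ L i ∧ p ∈ L j) ∨ (L i).Parallel (L j))
  symm := ⟨by
    rintro i j ⟨hij, ⟨p, hi, hj⟩ | h⟩
    · exact ⟨hij.symm, Or.inl ⟨p, hj, hi⟩⟩
    · exact ⟨hij.symm, Or.inr h.symm⟩⟩
  loopless := ⟨fun _ h => h.1 rfl⟩

/-- The Zariski closure of a set of points of affine space: the common zeros of all polynomials
that vanish on the set. -/
def zariskiClosure {σ : Type*} (S : Set (σ → ℂ)) : Set (σ → ℂ) :=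
  MvPolynomial.zeroLocus ℂ (MvPolynomial.vanishingIdeal ℂ S)

theorem subset_zariskiClosure {σ : Type*} (S : Set (σ → ℂ)) : S ⊆ zariskiClosure S :=
  MvPolynomial.zeroLocus_vanishingIdeal_le S

/-- The Zariski closure is the smallest algebraic set that contains the given set. -/
theorem zariskiClosure_subset {σ : Type*} {S : Set (σ → ℂ)} {I : Ideal (MvPolynomial σ ℂ)}
    (h : S ⊆ MvPolynomial.zeroLocus ℂ I) : zariskiClosure S ⊆ MvPolynomial.zeroLocus ℂ I :=
  MvPolynomial.zeroLocus_anti_mono (MvPolynomial.le_zeroLocus_iff_le_vanishingIdeal.1 h)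

/-- The dimension of an affine variety `X`: the Krull dimension of its coordinate ring
`ℂ[z] / I(X)`. -/
noncomputable def dimension {σ : Type*} (X : Set (σ → ℂ)) : WithBot ℕ∞ :=
  ringKrullDim (MvPolynomial σ ℂ ⧸ MvPolynomial.vanishingIdeal ℂ X)

/-- The set of all `x` such that `G` is contained in the intersection graph of `L(x)` and the lines
of `L(x)` are pairwise distinct. -/
def realizationSet {n : ℕ} (G : SimpleGraph (Fin n)) : Set (Fin n × Fin 4 → ℂ) :=
  {x | G ≤ intersectionGraph (lines x) ∧ Function.Injective (lines x)}

/-- The variety `X_G`. -/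
def realizationVariety {n : ℕ} (G : SimpleGraph (Fin n)) : Set (Fin n × Fin 4 → ℂ) :=
  zariskiClosure (realizationSet G)

/-- Laman graphs: `|E| = 2|V| - 3`, and `|E'| ≤ 2|V'| - 3` for every subgraph `(V', E')` with at
least two vertices. The (in)equalities are between integers. -/
def IsLaman {V : Type*} [Fintype V] (G : SimpleGraph V) : Prop :=
  (G.edgeSet.ncard : ℤ) = 2 * (Fintype.card V : ℤ) - 3 ∧
    ∀ H : G.Subgraph, 2 ≤ H.verts.ncard →
      (H.edgeSet.ncard : ℤ) ≤ 2 * (H.verts.ncard : ℤ) - 3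

end LineConfig

-- Read the parameters of a line as a 2×2 matrix with rows (a, b) and (c, d). Two lines are coplanar
-- exactly when the difference of their matrices is singular, so every edge is one quadratic
-- equation `lineForm = 0`, and the expected dimension is 4n - |E| = 2n + 3.
--
-- Lower bound: n lines through a common point realize every graph. The point and the directions
-- give 3 + 2n parameters, and for n ≥ 2 they are determined by the lines
-- (`isAlgebraic_range_concurrentHom`).
--
-- Upper bound: on each irreducible component, take the generic point ξ, a tuple of distinct lines
-- over the function field K. It suffices that ξ is algebraic over 4n - |E| elements of K
-- (`exists_card_add_adjPairs_le`). Sparsity gives a vertex w of degree at most 3; remove it and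
-- induct. The line of w should cost 4 - deg w parameters. This holds except when w has three
-- neighbours whose lines are pairwise coplanar: then w may cost 2 instead of 1. But in that case
-- any edge between neighbours of w is satisfied by ξ anyway, and the inverse Henneberg move
-- (`IsLamanSparse.exists_sup_edge`) provides a missing one that keeps the graph sparse. The
-- induction hypothesis for the enlarged graph saves one parameter, which pays for the excess.

universe u

/-! ### Krull dimension and transcendence degree. -/

/-- Chains of primes lift along injective integral extensions. -/
theorem ringKrullDim_le_of_isIntegral_of_injective {R S : Type*} [CommRing R] [CommRing S]
    [Algebra R S] [Algebra.IsIntegral R S] (hinj : Function.Injective (algebraMap R S)) :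
    ringKrullDim R ≤ ringKrullDim S := by
  have key (l : LTSeries (PrimeSpectrum R)) : ∃ l' : LTSeries (PrimeSpectrum S),
      l'.length = l.length ∧ l'.last.asIdeal.comap (algebraMap R S) = l.last.asIdeal := by
    induction l using RelSeries.inductionOn' with
    | singleton p =>
      obtain ⟨Q, -, hQ, hQp⟩ := Ideal.exists_ideal_over_prime_of_isIntegral (S := S) p.asIdeal ⊥
        (((RingHom.injective_iff_ker_eq_bot _).1 hinj).trans_le bot_le)
      exact ⟨RelSeries.singleton _ ⟨Q, hQ⟩, rfl, hQp⟩
    | snoc l p hp ih =>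
      obtain ⟨l', hl, hlast⟩ := ih
      have hlt : l.last < p := hp
      obtain ⟨Q, hQ, hQ', hQp⟩ := Ideal.exists_ideal_over_prime_of_isIntegral
        p.asIdeal l'.last.asIdeal (by rw [hlast]; exact hlt.le)
      refine ⟨l'.snoc ⟨Q, hQ'⟩ (lt_of_le_of_ne (show _ ≤ Q from hQ) ?_), by simp [hl], by simpa using hQp⟩
      intro h
      have h1 : l'.last.asIdeal = Q := by rw [h]
      rw [h1, hQp] at hlast
      exact hlt.ne (PrimeSpectrum.ext hlast.symm)
  refine iSup_le fun l => ?_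
  obtain ⟨l', hl, -⟩ := key l
  rw [← hl]
  exact Order.LTSeries.length_le_krullDim l'

/-- If an integral domain `B` lies in a domain that is algebraic over `B`, the transcendence degree
of the latter is at most the Krull dimension of `B`. -/
theorem natCast_le_ringKrullDim_of_le_trdeg {k B D : Type u} [Field k] [CommRing B] [IsDomain B]
    [Algebra k B] [Algebra.FiniteType k B] [CommRing D] [IsDomain D] [Algebra k D] [Algebra B D]
    [IsScalarTower k B D] [FaithfulSMul B D] [Algebra.IsAlgebraic B D] {d : ℕ}
    (hd : (d : Cardinal) ≤ Algebra.trdeg k D) : (d : WithBot ℕ∞) ≤ ringKrullDim B := by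
  obtain ⟨s, g, hg, hint⟩ := exists_integral_inj_algHom_of_fg k B
  algebraize [g.toRingHom]
  have hinj : Function.Injective (algebraMap (MvPolynomial (Fin s) k) B) := hg
  have hdim : ((s : ℕ) : WithBot ℕ∞) ≤ ringKrullDim B := by
    have := ringKrullDim_le_of_isIntegral_of_injective hinj
    simpa [MvPolynomial.ringKrullDim_of_isNoetherianRing] using this
  refine le_trans ?_ hdim
  let _ : Algebra (MvPolynomial (Fin s) k) D :=
    ((algebraMap B D).comp (algebraMap (MvPolynomial (Fin s) k) B)).toAlgebra
  have : IsScalarTower (MvPolynomial (Fin s) k) B D := .of_algebraMap_eq fun _ => rfl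
  have : IsScalarTower k (MvPolynomial (Fin s) k) D := .of_algebraMap_eq fun x => by
    rw [RingHom.algebraMap_toAlgebra, RingHom.comp_apply, IsScalarTower.algebraMap_apply k B D]
    congr 1
    exact (g.commutes x).symm
  have : FaithfulSMul (MvPolynomial (Fin s) k) D :=
    (faithfulSMul_iff_algebraMap_injective _ _).2
      ((FaithfulSMul.algebraMap_injective B D).comp hinj)
  have : Algebra.IsAlgebraic (MvPolynomial (Fin s) k) D :=
    Algebra.IsAlgebraic.trans (MvPolynomial (Fin s) k) B D
  -- `D` is algebraic over the Noether normalization of `B`, so its transcendence degree is `s`.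
  rw [← trdeg_add_eq (R := k) (S := MvPolynomial (Fin s) k) (A := D),
    trdeg_eq_zero (R := MvPolynomial (Fin s) k) (A := D)] at hd
  simpa using hd

/-- The Krull dimension of a finitely generated algebra is at most the transcendence degree of the
residue fields of its minimal primes. -/
theorem ringKrullDim_le_of_forall_minimalPrimes {k A : Type u} [Field k] [CommRing A] [Algebra k A]
    [Algebra.FiniteType k A] {d : ℕ}
    (h : ∀ P : Ideal A, [P.IsPrime] → P ∈ minimalPrimes A →
      Algebra.trdeg k (FractionRing (A ⧸ P)) ≤ d) :
    ringKrullDim A ≤ d := by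
  refine iSup_le fun l => ?_
  obtain ⟨P, hP, hPl⟩ := Ideal.exists_minimalPrimes_le (bot_le (a := l.head.asIdeal))
  have hPp : P.IsPrime := hP.1.1
  have htr := h P hP
  obtain ⟨s, g, hg, hint⟩ := exists_integral_inj_algHom_of_fg k (A ⧸ P)
  have hs : s ≤ d := by
    have hi : Function.Injective ((IsScalarTower.toAlgHom k (A ⧸ P) (FractionRing (A ⧸ P))).comp g) :=
      (IsFractionRing.injective (A ⧸ P) (FractionRing (A ⧸ P))).comp hg
    simpa using (trdeg_le_of_injective _ hi).trans htr
  -- Lift the Noether normalization of `A ⧸ P` to a map `φ` into `A`. Since `A ⧸ P` is integral over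
  -- it, contraction along `φ` is strictly monotone on primes above `P`, so the chain is no longer
  -- than `s`.
  choose f hf using fun i => Ideal.Quotient.mk_surjective (I := P) (g (MvPolynomial.X i))
  let φ : MvPolynomial (Fin s) k →ₐ[k] A := MvPolynomial.aeval f
  have hφ : ∀ x, Ideal.Quotient.mk P (φ x) = g x := by
    have : (Ideal.Quotient.mkₐ k P).comp φ = g := by ext i; simp [φ, hf]
    exact fun x => DFunLike.congr_fun this x
  have hmono (I J : PrimeSpectrum A) (hI : P ≤ I.asIdeal) (hIJ : I < J) :
      PrimeSpectrum.comap φ.toRingHom I < PrimeSpectrum.comap φ.toRingHom J := by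
    obtain ⟨x, hxJ, hxI⟩ := SetLike.exists_of_lt (show I.asIdeal < J.asIdeal from hIJ)
    obtain ⟨p, hp, hpx⟩ := hint (Ideal.Quotient.mk P x)
    refine Ideal.comap_lt_comap_of_root_mem_sdiff (f := φ.toRingHom) hIJ.le ⟨hxJ, hxI⟩
      (Polynomial.map_monic_ne_zero hp) (hI ?_)
    rw [← Ideal.Quotient.eq_zero_iff_mem, Polynomial.hom_eval₂, ← hpx]
    congr 1
    ext x <;> simp [hφ]
  have hle (i) : P ≤ (l i).asIdeal := hPl.trans (l.head_le i)
  let l' : LTSeries (PrimeSpectrum (MvPolynomial (Fin s) k)) :=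
    ⟨l.length, fun i => PrimeSpectrum.comap φ.toRingHom (l i), fun i => hmono _ _ (hle _) (l.step i)⟩
  have := Order.LTSeries.length_le_krullDim l'
  have h2 : ringKrullDim (MvPolynomial (Fin s) k) = s := by
    simp [MvPolynomial.ringKrullDim_of_isNoetherianRing]
  refine (this.trans h2.le).trans (by exact_mod_cast hs)

/-! ### Algebraic dependence as a closure operator. -/

section RelAlgClosure

variable {k K : Type*} [Field k] [Field K] [Algebra k K]

/-- The elements of `K` that are algebraic over the subfield generated by `k` and `S`. -/
noncomputable def relAlgClosure (k : Type*) {K : Type*} [Field k] [Field K] [Algebra k K]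
    (S : Set K) : IntermediateField k K :=
  (algebraicClosure (IntermediateField.adjoin k S) K).restrictScalars k

theorem mem_relAlgClosure {S : Set K} {x : K} :
    x ∈ relAlgClosure k S ↔ IsAlgebraic (IntermediateField.adjoin k S) x := by
  rw [relAlgClosure, IntermediateField.mem_restrictScalars, mem_algebraicClosure_iff]

theorem subset_relAlgClosure (S : Set K) : S ⊆ relAlgClosure k S := fun x hx =>
  mem_relAlgClosure.2 (isAlgebraic_algebraMap
    (⟨x, IntermediateField.subset_adjoin k S hx⟩ : IntermediateField.adjoin k S))

theorem mem_relAlgClosure_of_isAlgebraic {S : Set K} {x : K}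
    (hx : IsAlgebraic (relAlgClosure k S) x) : x ∈ relAlgClosure k S := by
  have hx' : IsAlgebraic (algebraicClosure (IntermediateField.adjoin k S) K) x := hx
  exact mem_relAlgClosure.2 (hx'.restrictScalars _)

/-- Transitivity of algebraic dependence: the closure of `T` is algebraically closed in `K`. -/
theorem relAlgClosure_le {S T : Set K} (h : S ⊆ relAlgClosure k T) :
    relAlgClosure k S ≤ relAlgClosure k T := fun x hx => by
  have hle : IntermediateField.adjoin k S ≤ relAlgClosure k T :=
    IntermediateField.adjoin_le_iff.2 h
  refine mem_relAlgClosure_of_isAlgebraic ?_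
  obtain ⟨p, hp, hpx⟩ := mem_relAlgClosure.1 hx
  refine ⟨p.map (IntermediateField.inclusion hle).toRingHom,
    (Polynomial.map_ne_zero_iff (IntermediateField.inclusion hle).injective).2 hp, ?_⟩
  rw [Polynomial.aeval_def, Polynomial.eval₂_map]
  exact hpx

theorem relAlgClosure_mono {S T : Set K} (h : S ⊆ T) : relAlgClosure k S ≤ relAlgClosure k T :=
  relAlgClosure_le (h.trans (subset_relAlgClosure T))

theorem mem_relAlgClosure_of_quadratic {S : Set K} {a b c x : K} (ha : a ∈ relAlgClosure k S)
    (hb : b ∈ relAlgClosure k S) (hc : c ∈ relAlgClosure k S) (ha0 : a ≠ 0)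
    (hx : a * x ^ 2 + b * x + c = 0) : x ∈ relAlgClosure k S := by
  refine mem_relAlgClosure_of_isAlgebraic ⟨Polynomial.C ⟨a, ha⟩ * Polynomial.X ^ 2 +
    Polynomial.C ⟨b, hb⟩ * Polynomial.X + Polynomial.C ⟨c, hc⟩, fun h => ha0 ?_, ?_⟩
  · have := congrArg (Polynomial.coeff · 2) h
    simpa [Polynomial.coeff_X, Polynomial.coeff_C] using congrArg Subtype.val this
  · simpa using hx

open scoped IntermediateField.algebraAdjoinAdjoin in
theorem trdeg_le_card_of_relAlgClosure_eq_top {T : Finset K}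
    (h : relAlgClosure k (T : Set K) = ⊤) : Algebra.trdeg k K ≤ T.card := by
  have h1 : ∀ x : K, IsAlgebraic (Algebra.adjoin k (T : Set K)) x := fun x =>
    (mem_relAlgClosure.1 (h ▸ IntermediateField.mem_top)).restrictScalars _
  have : Algebra.IsAlgebraic (Algebra.adjoin k (T : Set K)) K := ⟨h1⟩
  simpa using Algebra.IsAlgebraic.trdeg_le_cardinalMk k (T : Set K)

end RelAlgClosure

/-! ### Parameter counts for a line coplanar with one, two or three given lines. -/

section Fibres

variable {k K : Type*} [Field k] [Field K] [Algebra k K]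

/-- The quadratic form `ad - bc`, which vanishes on the difference of the parameters of two
non-horizontal lines if and only if these lines are coplanar. -/
def lineForm {R : Type*} [CommRing R] (u : Fin 4 → R) : R := u 0 * u 3 - u 1 * u 2

/-- A point of a quadric cone is determined up to finitely many choices by three coordinates. -/
theorem exists_card_le_three_of_mul_eq_mul (S : Set K) {y₁ y₂ y₃ y₄ : K}
    (h : y₁ * y₄ = y₂ * y₃) : ∃ T : Finset K, T.card ≤ 3 ∧
      {y₁, y₂, y₃, y₄} ⊆ (relAlgClosure k (S ∪ T) : Set K) := by
  classical
  by_cases h4 : y₄ = 0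
  · have h23 : y₂ = 0 ∨ y₃ = 0 := by
      rw [h4, mul_zero] at h
      exact mul_eq_zero.1 h.symm
    refine ⟨{y₁, y₂, y₃}, Finset.card_le_three, ?_⟩
    have hT := subset_relAlgClosure (k := k) (S ∪ ↑({y₁, y₂, y₃} : Finset K))
    rintro x (rfl | rfl | rfl | rfl)
    · exact hT (by simp)
    · exact hT (by simp)
    · exact hT (by simp)
    · rw [h4]; exact zero_mem _
  · refine ⟨{y₂, y₃, y₄}, Finset.card_le_three, ?_⟩
    have hT := subset_relAlgClosure (k := k) (S ∪ ↑({y₂, y₃, y₄} : Finset K))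
    have m2 := hT (show y₂ ∈ _ by simp)
    have m3 := hT (show y₃ ∈ _ by simp)
    have m4 := hT (show y₄ ∈ _ by simp)
    rintro x (rfl | rfl | rfl | rfl)
    · rw [eq_div_of_mul_eq h4 h]
      exact div_mem (mul_mem m2 m3) m4
    exacts [m2, m3, m4]

/-- Eliminating `y₁` gives y₂ (y₃ - β y₄) = (α y₄ + γ y₃ + δ) y₄. Either `y₂` is a rational function
of `y₃`, `y₄`, or y₃ = β y₄ and then `y₂`, `y₄` determine the rest. -/
theorem exists_card_le_two_of_eq_linear {S : Set K} {y₁ y₂ y₃ y₄ α β γ δ : K}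
    (hα : α ∈ relAlgClosure k S) (hβ : β ∈ relAlgClosure k S) (hγ : γ ∈ relAlgClosure k S)
    (hδ : δ ∈ relAlgClosure k S) (h : y₁ * y₄ = y₂ * y₃)
    (h1 : y₁ = α * y₄ + β * y₂ + γ * y₃ + δ) : ∃ T : Finset K, T.card ≤ 2 ∧
      {y₁, y₂, y₃, y₄} ⊆ (relAlgClosure k (S ∪ T) : Set K) := by
  classical
  have up (T : Finset K) : relAlgClosure k S ≤ relAlgClosure k (S ∪ T) :=
    relAlgClosure_mono Set.subset_union_left
  by_cases h3 : y₃ = β * y₄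
  · refine ⟨{y₂, y₄}, Finset.card_le_two, ?_⟩
    have hT := subset_relAlgClosure (k := k) (S ∪ ↑({y₂, y₄} : Finset K))
    have m2 := hT (show y₂ ∈ _ by simp)
    have m4 := hT (show y₄ ∈ _ by simp)
    have m3 : y₃ ∈ relAlgClosure k (S ∪ ↑({y₂, y₄} : Finset K)) := by
      rw [h3]; exact mul_mem (up _ hβ) m4
    rintro x (rfl | rfl | rfl | rfl)
    · rw [h1]
      exact add_mem (add_mem (add_mem (mul_mem (up _ hα) m4) (mul_mem (up _ hβ) m2))
        (mul_mem (up _ hγ) m3)) (up _ hδ)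
    exacts [m2, m3, m4]
  · refine ⟨{y₃, y₄}, Finset.card_le_two, ?_⟩
    have hT := subset_relAlgClosure (k := k) (S ∪ ↑({y₃, y₄} : Finset K))
    have m3 := hT (show y₃ ∈ _ by simp)
    have m4 := hT (show y₄ ∈ _ by simp)
    have m2 : y₂ ∈ relAlgClosure k (S ∪ ↑({y₃, y₄} : Finset K)) := by
      have : y₂ = (α * y₄ + γ * y₃ + δ) * y₄ / (y₃ - β * y₄) := by
        rw [eq_div_iff (sub_ne_zero.2 h3)]
        rw [h1] at h
        linear_combination -h
      rw [this]
      exact div_mem (mul_mem (add_mem (add_mem (mul_mem (up _ hα) m4) (mul_mem (up _ hγ) m3))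
        (up _ hδ)) m4) (sub_mem m3 (mul_mem (up _ hβ) m4))
    rintro x (rfl | rfl | rfl | rfl)
    · rw [h1]
      exact add_mem (add_mem (add_mem (mul_mem (up _ hα) m4) (mul_mem (up _ hβ) m2))
        (mul_mem (up _ hγ) m3)) (up _ hδ)
    exacts [m2, m3, m4]

/-- A quadric cone and a hyperplane meet in dimension two. -/
theorem exists_card_le_two_of_linear {S : Set K} {y₁ y₂ y₃ y₄ v₁ v₂ v₃ v₄ e : K}
    (hv₁ : v₁ ∈ relAlgClosure k S) (hv₂ : v₂ ∈ relAlgClosure k S) (hv₃ : v₃ ∈ relAlgClosure k S)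
    (hv₄ : v₄ ∈ relAlgClosure k S) (he : e ∈ relAlgClosure k S)
    (hv : ¬(v₁ = 0 ∧ v₂ = 0 ∧ v₃ = 0 ∧ v₄ = 0)) (h : y₁ * y₄ = y₂ * y₃)
    (hlin : y₁ * v₄ + y₄ * v₁ - y₂ * v₃ - y₃ * v₂ = e) : ∃ T : Finset K, T.card ≤ 2 ∧
      {y₁, y₂, y₃, y₄} ⊆ (relAlgClosure k (S ∪ T) : Set K) := by
  have key {y₁ y₂ y₃ y₄ v₁ v₂ v₃ v₄ e : K}
      (hv₁ : v₁ ∈ relAlgClosure k S) (hv₂ : v₂ ∈ relAlgClosure k S) (hv₃ : v₃ ∈ relAlgClosure k S)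
      (hv₄ : v₄ ∈ relAlgClosure k S) (he : e ∈ relAlgClosure k S)
      (hv : v₄ ≠ 0) (h : y₁ * y₄ = y₂ * y₃)
      (hlin : y₁ * v₄ + y₄ * v₁ - y₂ * v₃ - y₃ * v₂ = e) : ∃ T : Finset K, T.card ≤ 2 ∧
        {y₁, y₂, y₃, y₄} ⊆ (relAlgClosure k (S ∪ T) : Set K) := by
    refine exists_card_le_two_of_eq_linear (div_mem (neg_mem hv₁) hv₄) (div_mem hv₃ hv₄)
      (div_mem hv₂ hv₄) (div_mem he hv₄) h ?_
    field_simp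
    linear_combination hlin
  -- Permutations of the coordinates that preserve the quadratic form up to sign move a nonzero `vᵢ`
  -- into the last place; those that change the sign turn `e` into `-e`.
  by_cases h4 : v₄ = 0
  · by_cases h1 : v₁ = 0
    · by_cases h3 : v₃ = 0
      · have h2 : v₂ ≠ 0 := fun h2 => hv ⟨h1, h2, h3, h4⟩
        obtain ⟨T, hT, hy⟩ := key (y₁ := y₃) (y₂ := y₄) (y₃ := y₁) (y₄ := y₂)
          hv₃ hv₄ hv₁ hv₂ (neg_mem he) h2
          (by linear_combination -h) (by linear_combination -hlin)
        exact ⟨T, hT, fun x hx => hy (by simp at hx ⊢; tauto)⟩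
      · obtain ⟨T, hT, hy⟩ := key (y₁ := y₂) (y₂ := y₁) (y₃ := y₄) (y₄ := y₃)
          hv₂ hv₁ hv₄ hv₃ (neg_mem he) h3
          (by linear_combination -h) (by linear_combination -hlin)
        exact ⟨T, hT, fun x hx => hy (by simp at hx ⊢; tauto)⟩
    · obtain ⟨T, hT, hy⟩ := key (y₁ := y₄) (y₂ := y₂) (y₃ := y₃) (y₄ := y₁)
          hv₄ hv₂ hv₃ hv₁ he h1 (by linear_combination h) (by linear_combination hlin)
      exact ⟨T, hT, fun x hx => hy (by simp at hx ⊢; tauto)⟩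
  · exact key hv₁ hv₂ hv₃ hv₄ he h4 h hlin

/-- An idempotent `2 × 2` matrix of trace one that satisfies another linear equation varies in
dimension one. -/
theorem exists_card_le_one_of_linear {S : Set K} {a b c p q r e : K}
    (hp : p ∈ relAlgClosure k S) (hq : q ∈ relAlgClosure k S) (hr : r ∈ relAlgClosure k S)
    (he : e ∈ relAlgClosure k S) (hpqr : ¬(p = 0 ∧ q = 0 ∧ r = 0)) (h : a * (1 - a) = b * c)
    (hlin : a * p + b * q + c * r = e) : ∃ T : Finset K, T.card ≤ 1 ∧
      {a, b, c} ⊆ (relAlgClosure k (S ∪ T) : Set K) := by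
  have up (T : Finset K) : relAlgClosure k S ≤ relAlgClosure k (S ∪ T) :=
    relAlgClosure_mono Set.subset_union_left
  have key {b c q r : K} (hq : q ∈ relAlgClosure k S) (hr : r ∈ relAlgClosure k S)
      (hq0 : q ≠ 0) (h : a * (1 - a) = b * c) (hlin : a * p + b * q + c * r = e) :
      ∃ T : Finset K, T.card ≤ 1 ∧ {a, b, c} ⊆ (relAlgClosure k (S ∪ T) : Set K) := by
    refine ⟨{c}, by simp, ?_⟩
    have mc := subset_relAlgClosure (k := k) (S ∪ ↑({c} : Finset K)) (show c ∈ _ by simp)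
    have ma : a ∈ relAlgClosure k (S ∪ ↑({c} : Finset K)) := by
      -- Multiply a(1 - a) = bc by `q` and replace bq by e - ap - cr: this is a quadratic equation
      -- for `a` over `c`.
      refine mem_relAlgClosure_of_quadratic (a := q) (b := -(q + p * c)) (c := (e - c * r) * c)
        (up _ hq) (neg_mem (add_mem (up _ hq) (mul_mem (up _ hp) mc)))
        (mul_mem (sub_mem (up _ he) (mul_mem mc (up _ hr))) mc) hq0 ?_
      linear_combination -q * h - c * hlin
    have mb : b ∈ relAlgClosure k (S ∪ ↑({c} : Finset K)) := by
      have : b = (e - a * p - c * r) / q := by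
        rw [eq_div_iff hq0]; linear_combination hlin
      rw [this]
      exact div_mem (sub_mem (sub_mem (up _ he) (mul_mem ma (up _ hp))) (mul_mem mc (up _ hr)))
        (up _ hq)
    rintro x (rfl | rfl | rfl)
    exacts [ma, mb, mc]
  by_cases hq0 : q = 0
  · by_cases hr0 : r = 0
    · have hp0 : p ≠ 0 := fun hp0 => hpqr ⟨hp0, hq0, hr0⟩
      have ha : a ∈ relAlgClosure k S := by
        have : a = e / p := by
          rw [eq_div_iff hp0]; simpa [hq0, hr0] using hlin
        rw [this]
        exact div_mem he hp
      by_cases hc : c = 0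
      · refine ⟨{b}, by simp, ?_⟩
        have mb := subset_relAlgClosure (k := k) (S ∪ ↑({b} : Finset K)) (show b ∈ _ by simp)
        rintro x (rfl | rfl | rfl)
        exacts [up _ ha, mb, hc ▸ zero_mem _]
      · refine ⟨{c}, by simp, ?_⟩
        have mc := subset_relAlgClosure (k := k) (S ∪ ↑({c} : Finset K)) (show c ∈ _ by simp)
        have mb : b ∈ relAlgClosure k (S ∪ ↑({c} : Finset K)) := by
          rw [eq_div_of_mul_eq hc h.symm]
          exact div_mem (mul_mem (up _ ha) (sub_mem (one_mem _) (up _ ha))) mc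
        rintro x (rfl | rfl | rfl)
        exacts [up _ ha, mb, mc]
    · obtain ⟨T, hT, hy⟩ := key (b := c) (c := b) hr hq hr0 (by linear_combination h)
        (by linear_combination hlin)
      exact ⟨T, hT, fun x hx => hy (by simp at hx ⊢; tauto)⟩
  · exact key hq hr hq0 h hlin

/-- The lines that are coplanar with one given line vary in dimension three. -/
theorem exists_card_le_three_of_lineForm_eq_zero {S : Set K} {y u : Fin 4 → K}
    (hu : ∀ i, u i ∈ relAlgClosure k S) (hy : lineForm (y - u) = 0) :
    ∃ T : Finset K, T.card ≤ 3 ∧ ∀ i, y i ∈ relAlgClosure k (S ∪ T) := by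
  obtain ⟨T, hT, h⟩ := exists_card_le_three_of_mul_eq_mul (k := k) S (sub_eq_zero.1 hy)
  refine ⟨T, hT, fun i => ?_⟩
  have h' : (y - u) i ∈ relAlgClosure k (S ∪ T) := h (by fin_cases i <;> simp)
  simpa using add_mem h' (relAlgClosure_mono Set.subset_union_left (hu i))

/-- The lines that are coplanar with two distinct given lines vary in dimension two. -/
theorem exists_card_le_two_of_lineForm_eq_zero {S : Set K} {y u v : Fin 4 → K}
    (hu : ∀ i, u i ∈ relAlgClosure k S) (hv : ∀ i, v i ∈ relAlgClosure k S) (huv : u ≠ v)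
    (hyu : lineForm (y - u) = 0) (hyv : lineForm (y - v) = 0) :
    ∃ T : Finset K, T.card ≤ 2 ∧ ∀ i, y i ∈ relAlgClosure k (S ∪ T) := by
  have hw (i) : (v - u) i ∈ relAlgClosure k S := sub_mem (hv i) (hu i)
  have hne : ¬((v - u) 0 = 0 ∧ (v - u) 1 = 0 ∧ (v - u) 2 = 0 ∧ (v - u) 3 = 0) := by
    rintro ⟨h0, h1, h2, h3⟩
    refine huv (sub_eq_zero.1 ?_).symm
    ext i
    fin_cases i <;> assumption
  -- Subtracting the two quadratic equations leaves a linear one: the polar form of y - u and v - u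
  -- equals `lineForm (v - u)`.
  obtain ⟨T, hT, h⟩ := exists_card_le_two_of_linear (k := k) (S := S) (hw 0) (hw 1) (hw 2) (hw 3)
    (e := lineForm (v - u)) (sub_mem (mul_mem (hw 0) (hw 3)) (mul_mem (hw 1) (hw 2)))
    hne (sub_eq_zero.1 hyu) (by
      simp only [lineForm, Pi.sub_apply] at *
      linear_combination hyu - hyv)
  refine ⟨T, hT, fun i => ?_⟩
  have h' : (y - u) i ∈ relAlgClosure k (S ∪ T) := h (by fin_cases i <;> simp)
  simpa using add_mem h' (relAlgClosure_mono Set.subset_union_left (hu i))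

/-- The lines that are coplanar with three distinct given lines, two of which are skew, vary in
dimension one. -/
theorem exists_card_le_one_of_lineForm_eq_zero {S : Set K} {y u v x : Fin 4 → K}
    (hu : ∀ i, u i ∈ relAlgClosure k S) (hv : ∀ i, v i ∈ relAlgClosure k S)
    (hx : ∀ i, x i ∈ relAlgClosure k S) (huv : lineForm (v - u) ≠ 0) (hux : u ≠ x) (hvx : v ≠ x)
    (hyu : lineForm (y - u) = 0) (hyv : lineForm (y - v) = 0) (hyx : lineForm (y - x) = 0) :
    ∃ T : Finset K, T.card ≤ 1 ∧ ∀ i, y i ∈ relAlgClosure k (S ∪ T) := by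
  -- In matrix terms, m = v - u is invertible because `u` and `v` are skew, and w = m⁻¹z by Cramer's
  -- rule. For Y = m⁻¹(y - u) the conditions become det Y = det(Y - 1) = 0, that is, determinant 0
  -- and trace 1, together with det(Y - X) = 0 for X = m⁻¹(x - u), which is then linear in the
  -- entries of `Y`.
  have solve (z : Fin 4 → K) : ∃ w : Fin 4 → K, (∀ L : IntermediateField k K,
      (∀ i, (v - u) i ∈ L) → (∀ i, z i ∈ L) → ∀ i, w i ∈ L) ∧
      z = ![(v - u) 0 * w 0 + (v - u) 1 * w 2, (v - u) 0 * w 1 + (v - u) 1 * w 3,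
        (v - u) 2 * w 0 + (v - u) 3 * w 2, (v - u) 2 * w 1 + (v - u) 3 * w 3] := by
    generalize v - u = m at huv ⊢
    refine ⟨![(m 3 * z 0 - m 1 * z 2) / lineForm m, (m 3 * z 1 - m 1 * z 3) / lineForm m,
      (m 0 * z 2 - m 2 * z 0) / lineForm m, (m 0 * z 3 - m 2 * z 1) / lineForm m],
      fun L hm hz i => ?_, ?_⟩
    · have hD : lineForm m ∈ L := sub_mem (mul_mem (hm 0) (hm 3)) (mul_mem (hm 1) (hm 2))
      fin_cases i <;> exact div_mem (sub_mem (mul_mem (hm _) (hz _)) (mul_mem (hm _) (hz _))) hD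
    · ext i
      fin_cases i <;> simp <;> field_simp <;> simp only [lineForm] <;> ring
  have hm (i) : (v - u) i ∈ relAlgClosure k S := sub_mem (hv i) (hu i)
  obtain ⟨X, hX, hxX⟩ := solve (x - u)
  obtain ⟨Y, -, hyY⟩ := solve (y - u)
  replace hX := hX _ hm fun i => sub_mem (hx i) (hu i)
  have e (z : Fin 4 → K) (i) : z i = u i + (z - u) i := by simp
  generalize hmdef : v - u = m at *
  have hY : Y 0 * Y 3 - Y 1 * Y 2 = 0 := by
    refine (mul_eq_zero.1 (?_ : lineForm m * _ = 0)).resolve_left huv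
    rw [← hyu, hyY]; simp [lineForm]; ring
  have hY1 : (Y 0 - 1) * (Y 3 - 1) - Y 1 * Y 2 = 0 := by
    refine (mul_eq_zero.1 (?_ : lineForm m * _ = 0)).resolve_left huv
    rw [← hyv, show y - v = (y - u) - m by rw [← hmdef]; ring, hyY]; simp [lineForm]; ring
  have hYX : (Y 0 - X 0) * (Y 3 - X 3) - (Y 1 - X 1) * (Y 2 - X 2) = 0 := by
    refine (mul_eq_zero.1 (?_ : lineForm m * _ = 0)).resolve_left huv
    rw [← hyx, show y - x = (y - u) - (x - u) by ring, hyY, hxX]; simp [lineForm]; ring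
  have h3 : Y 3 = 1 - Y 0 := by linear_combination hY - hY1
  rw [h3] at hY hYX
  -- The linear equation degenerates only for a scalar matrix X = λ. Then λ(λ - 1) = 0, so that x =
  -- u or x = v.
  have hne : ¬(X 3 - X 0 = 0 ∧ -X 2 = 0 ∧ -X 1 = 0) := by
    rintro ⟨hp, hq, hr⟩
    have hq' : X 2 = 0 := neg_eq_zero.1 hq
    have hr' : X 1 = 0 := neg_eq_zero.1 hr
    have hp' : X 3 = X 0 := sub_eq_zero.1 hp
    rw [hp', hq', hr'] at hYX
    have h01 : X 0 * (X 0 - 1) = 0 := by linear_combination hYX - hY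
    rcases mul_eq_zero.1 h01 with h0 | h0
    · refine hux ?_
      ext i
      rw [e x i, hxX, hp', hq', hr', h0]
      fin_cases i <;> simp
    · refine hvx ?_
      ext i
      rw [e x i, hxX, hp', hq', hr', sub_eq_zero.1 h0, e v i, hmdef]
      fin_cases i <;> simp
  obtain ⟨T, hT, h⟩ := exists_card_le_one_of_linear (k := k) (S := S) (a := Y 0) (b := Y 1)
    (c := Y 2) (p := X 3 - X 0) (q := -X 2) (r := -X 1) (e := X 0 * X 3 - X 1 * X 2 - X 0)
    (sub_mem (hX 3) (hX 0)) (neg_mem (hX 2)) (neg_mem (hX 1))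
    (sub_mem (sub_mem (mul_mem (hX 0) (hX 3)) (mul_mem (hX 1) (hX 2))) (hX 0))
    hne (by linear_combination hY) (by linear_combination hY - hYX)
  have up : relAlgClosure k S ≤ relAlgClosure k (S ∪ T) :=
    relAlgClosure_mono Set.subset_union_left
  refine ⟨T, hT, fun i => ?_⟩
  have m0 : Y 0 ∈ relAlgClosure k (S ∪ T) := h (by simp)
  have m1 : Y 1 ∈ relAlgClosure k (S ∪ T) := h (by simp)
  have m2 : Y 2 ∈ relAlgClosure k (S ∪ T) := h (by simp)
  have m3 : Y 3 ∈ relAlgClosure k (S ∪ T) := by rw [h3]; exact sub_mem (one_mem _) m0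
  rw [e y i]
  refine add_mem (up (hu i)) ?_
  rw [hyY]
  fin_cases i
  · exact add_mem (mul_mem (up (hm _)) m0) (mul_mem (up (hm _)) m2)
  · exact add_mem (mul_mem (up (hm _)) m1) (mul_mem (up (hm _)) m3)
  · exact add_mem (mul_mem (up (hm _)) m0) (mul_mem (up (hm _)) m2)
  · exact add_mem (mul_mem (up (hm _)) m1) (mul_mem (up (hm _)) m3)

end Fibres

/-! ### Laman-sparse graphs and the inverse Henneberg move. -/

section Sparse

variable {V : Type*}

open scoped Classical in
/-- The ordered pairs of adjacent vertices inside a finite set of vertices. -/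
noncomputable def adjPairs (G : SimpleGraph V) (A : Finset V) : Finset (V × V) :=
  (A ×ˢ A).filter fun p => G.Adj p.1 p.2

open scoped Classical in
/-- The neighbours of a vertex inside a finite set of vertices. -/
noncomputable def neighborsIn (G : SimpleGraph V) (A : Finset V) (w : V) : Finset V :=
  A.filter (G.Adj w)

/-- Every set of at least two vertices of `A` spans at most `2|B| - 3` edges; the edges are counted
as ordered pairs. -/
def IsLamanSparse (G : SimpleGraph V) (A : Finset V) : Prop :=
  ∀ B ⊆ A, 2 ≤ B.card → (adjPairs G B).card + 6 ≤ 4 * B.card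

variable {G : SimpleGraph V} {A B C D : Finset V}

theorem mem_adjPairs {p : V × V} :
    p ∈ adjPairs G A ↔ (p.1 ∈ A ∧ p.2 ∈ A) ∧ G.Adj p.1 p.2 := by
  simp [adjPairs]

theorem mem_neighborsIn {w v : V} : v ∈ neighborsIn G A w ↔ v ∈ A ∧ G.Adj w v := by
  simp [neighborsIn]

theorem IsLamanSparse.mono (h : IsLamanSparse G A) (hBA : B ⊆ A) : IsLamanSparse G B :=
  fun C hC => h C (hC.trans hBA)

theorem sum_card_neighborsIn (G : SimpleGraph V) (A : Finset V) :
    ∑ w ∈ A, (neighborsIn G A w).card = (adjPairs G A).card := by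
  classical
  rw [adjPairs, Finset.card_filter, Finset.sum_product]
  exact Finset.sum_congr rfl fun w _ => Finset.card_filter _ _

theorem adjPairs_eq_empty (h : A.card ≤ 1) : adjPairs G A = ∅ := by
  refine Finset.eq_empty_of_forall_notMem fun p hp => ?_
  obtain ⟨⟨h1, h2⟩, hadj⟩ := mem_adjPairs.1 hp
  exact hadj.ne (Finset.card_le_one.1 h _ h1 _ h2)

theorem adjPairs_sup_edge_of_not_mem {u v : V} (h : ¬(u ∈ A ∧ v ∈ A)) :
    adjPairs (G ⊔ SimpleGraph.edge u v) A = adjPairs G A := by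
  ext ⟨a, b⟩
  simp only [mem_adjPairs, SimpleGraph.sup_adj, SimpleGraph.edge_adj]
  constructor
  · rintro ⟨⟨ha, hb⟩, hadj | ⟨⟨rfl, rfl⟩ | ⟨rfl, rfl⟩, -⟩⟩
    exacts [⟨⟨ha, hb⟩, hadj⟩, absurd ⟨ha, hb⟩ h, absurd ⟨hb, ha⟩ h]
  · exact fun ⟨h1, h2⟩ => ⟨h1, Or.inl h2⟩

/-- A sparse graph has a vertex of degree at most three. -/
theorem IsLamanSparse.exists_card_neighborsIn_le (h : IsLamanSparse G A) (hA : A.Nonempty) :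
    ∃ w ∈ A, (neighborsIn G A w).card ≤ 3 := by
  by_contra! hdeg
  have h1 := Finset.card_nsmul_le_sum A _ 4 hdeg
  rw [sum_card_neighborsIn, smul_eq_mul] at h1
  have h2 := hA.card_pos
  by_cases hc : 2 ≤ A.card
  · have := h A subset_rfl hc
    omega
  · rw [adjPairs_eq_empty (by omega), Finset.card_empty] at h1
    omega

variable [DecidableEq V]

theorem card_adjPairs_insert {w : V} (hw : w ∉ A) :
    (adjPairs G (insert w A)).card = (adjPairs G A).card + 2 * (neighborsIn G A w).card := by
  have h : adjPairs G (insert w A) = adjPairs G A ∪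
      ((neighborsIn G A w).image (fun v => (w, v)) ∪
        (neighborsIn G A w).image fun v => (v, w)) := by
    ext ⟨a, b⟩
    simp only [mem_adjPairs, Finset.mem_insert, Finset.mem_union, Finset.mem_image,
      mem_neighborsIn, Prod.mk.injEq]
    constructor
    · rintro ⟨⟨rfl | ha, rfl | hb⟩, hadj⟩
      · exact absurd hadj G.irrefl
      · exact Or.inr (Or.inl ⟨b, ⟨hb, hadj⟩, rfl, rfl⟩)
      · exact Or.inr (Or.inr ⟨a, ⟨ha, hadj.symm⟩, rfl, rfl⟩)
      · exact Or.inl ⟨⟨ha, hb⟩, hadj⟩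
    · rintro (⟨⟨ha, hb⟩, hadj⟩ | ⟨v, ⟨hv, hadj⟩, rfl, rfl⟩ | ⟨v, ⟨hv, hadj⟩, rfl, rfl⟩)
      · exact ⟨⟨Or.inr ha, Or.inr hb⟩, hadj⟩
      · exact ⟨⟨Or.inl rfl, Or.inr hv⟩, hadj⟩
      · exact ⟨⟨Or.inr hv, Or.inl rfl⟩, hadj.symm⟩
  rw [h, Finset.card_union_of_disjoint, Finset.card_union_of_disjoint,
    Finset.card_image_of_injective _ fun a b hab => (Prod.mk.inj hab).2,
    Finset.card_image_of_injective _ fun a b hab => (Prod.mk.inj hab).1, two_mul]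
  · rw [Finset.disjoint_left]
    rintro ⟨a, b⟩ h1 h2
    simp only [Finset.mem_image, mem_neighborsIn, Prod.mk.injEq] at h1 h2
    obtain ⟨v, ⟨hv, -⟩, rfl, rfl⟩ := h1
    obtain ⟨v', -, -, rfl⟩ := h2
    exact hw hv
  · rw [Finset.disjoint_left]
    rintro ⟨a, b⟩ h1 h2
    simp only [Finset.mem_union, Finset.mem_image, mem_neighborsIn, Prod.mk.injEq,
      mem_adjPairs] at h1 h2
    rcases h2 with ⟨v, -, rfl, -⟩ | ⟨v, -, -, rfl⟩
    exacts [hw h1.1.1, hw h1.1.2]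

theorem even_card_adjPairs (G : SimpleGraph V) (A : Finset V) : Even (adjPairs G A).card := by
  induction A using Finset.induction_on with
  | empty => simp [adjPairs]
  | insert w A hw ih => rw [card_adjPairs_insert hw]; exact ih.add (even_two_mul _)

/-- Supermodularity of the edge count, used to uncross tight sets. -/
theorem card_adjPairs_add_le (G : SimpleGraph V) (A B : Finset V) :
    (adjPairs G A).card + (adjPairs G B).card ≤
      (adjPairs G (A ∪ B)).card + (adjPairs G (A ∩ B)).card := by
  rw [← Finset.card_union_add_card_inter]
  refine add_le_add (Finset.card_le_card fun p hp => ?_) (Finset.card_le_card fun p hp => ?_)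
  · simp only [Finset.mem_union, mem_adjPairs] at hp ⊢
    tauto
  · simp only [Finset.mem_inter, mem_adjPairs] at hp ⊢
    tauto

theorem disjoint_adjPairs (h : (A ∩ B).card ≤ 1) : Disjoint (adjPairs G A) (adjPairs G B) := by
  rw [Finset.disjoint_left]
  intro p hA hB
  rw [mem_adjPairs] at hA hB
  exact hA.2.ne (Finset.card_le_one.1 h _ (Finset.mem_inter.2 ⟨hA.1.1, hB.1.1⟩) _
    (Finset.mem_inter.2 ⟨hA.1.2, hB.1.2⟩))

theorem card_adjPairs_sup_edge_le (u v : V) :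
    (adjPairs (G ⊔ SimpleGraph.edge u v) A).card ≤ (adjPairs G A).card + 2 := by
  have h : adjPairs (G ⊔ SimpleGraph.edge u v) A ⊆ adjPairs G A ∪ {(u, v), (v, u)} := by
    rintro ⟨a, b⟩ hp
    simp only [mem_adjPairs, SimpleGraph.sup_adj, SimpleGraph.edge_adj, Finset.mem_union,
      Finset.mem_insert, Finset.mem_singleton, Prod.mk.injEq] at hp ⊢
    tauto
  exact (Finset.card_le_card h).trans ((Finset.card_union_le _ _).trans
    (Nat.add_le_add_left Finset.card_le_two _))

theorem card_adjPairs_add_two_le {u v : V} (huv : u ≠ v) (hadj : ¬G.Adj u v) (hu : u ∈ A)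
    (hv : v ∈ A) :
    (adjPairs G A).card + 2 ≤ (adjPairs (G ⊔ SimpleGraph.edge u v) A).card := by
  have hd : Disjoint (adjPairs G A) {(u, v), (v, u)} := by
    rw [Finset.disjoint_right]
    intro p hp hp'
    rw [mem_adjPairs] at hp'
    rcases Finset.mem_insert.1 hp with rfl | hp
    · exact hadj hp'.2
    · rw [Finset.mem_singleton] at hp
      subst hp
      exact hadj hp'.2.symm
  rw [← Finset.card_pair (show ((u, v) : V × V) ≠ (v, u) from fun h => huv (Prod.mk.inj h).1),
    ← Finset.card_union_of_disjoint hd]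
  refine Finset.card_le_card ?_
  rintro ⟨a, b⟩ hp
  simp only [mem_adjPairs, SimpleGraph.sup_adj, SimpleGraph.edge_adj, Finset.mem_union,
    Finset.mem_insert, Finset.mem_singleton, Prod.mk.injEq] at hp ⊢
  rcases hp with h | ⟨rfl, rfl⟩ | ⟨rfl, rfl⟩
  · exact ⟨h.1, Or.inl h.2⟩
  · exact ⟨⟨hu, hv⟩, Or.inr ⟨Or.inl ⟨rfl, rfl⟩, huv⟩⟩
  · exact ⟨⟨hv, hu⟩, Or.inr ⟨Or.inr ⟨rfl, rfl⟩, huv.symm⟩⟩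

/-- If an edge cannot be added to a sparse graph, then its end points lie in a tight set. -/
theorem IsLamanSparse.exists_tight (h : IsLamanSparse G A) {u v : V} (hu : u ∈ A) (hv : v ∈ A)
    (huv : u ≠ v) (hbad : G.Adj u v ∨ ¬IsLamanSparse (G ⊔ SimpleGraph.edge u v) A) :
    ∃ B ⊆ A, u ∈ B ∧ v ∈ B ∧ 4 * B.card ≤ (adjPairs G B).card + 6 := by
  rcases hbad with hadj | hbad
  · refine ⟨{u, v}, by simp [Finset.insert_subset_iff, hu, hv], by simp, by simp, ?_⟩
    have hsub : ({(u, v), (v, u)} : Finset (V × V)) ⊆ adjPairs G {u, v} := by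
      intro p hp
      rw [mem_adjPairs]
      rcases Finset.mem_insert.1 hp with rfl | hp
      · simpa using hadj
      · rw [Finset.mem_singleton] at hp
        subst hp
        simpa using hadj.symm
    have := Finset.card_le_card hsub
    rw [Finset.card_pair (show ((u, v) : V × V) ≠ (v, u) from fun h => huv (Prod.mk.inj h).1)]
      at this
    rw [Finset.card_pair huv]
    omega
  · simp only [IsLamanSparse, not_forall, not_le] at hbad
    obtain ⟨B, hBA, hB, hlt⟩ := hbad
    have h1 := h B hBA hB
    by_cases hmem : u ∈ B ∧ v ∈ B
    · refine ⟨B, hBA, hmem.1, hmem.2, ?_⟩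
      have h2 := card_adjPairs_sup_edge_le (G := G) (A := B) u v
      -- The violated inequality alone gives only 4|B| ≤ |pairs| + 7; parity removes the last unit.
      obtain ⟨m, hm⟩ := even_card_adjPairs G B
      omega
    · rw [adjPairs_sup_edge_of_not_mem hmem] at hlt
      omega

/-- The inverse of a Henneberg move of the second kind: after the removal of a vertex of degree
three, an edge between two of its neighbours can be added. -/
theorem IsLamanSparse.exists_sup_edge {w u v x : V} (hw : w ∉ A)
    (h : IsLamanSparse G (insert w A)) (huv : u ≠ v) (hux : u ≠ x) (hvx : v ≠ x)
    (hN : neighborsIn G A w = {u, v, x}) :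
    ∃ p ∈ neighborsIn G A w, ∃ q ∈ neighborsIn G A w, p ≠ q ∧ ¬G.Adj p q ∧
      IsLamanSparse (G ⊔ SimpleGraph.edge p q) A := by
  have hA := h.mono (Finset.subset_insert w A)
  have hNu : u ∈ neighborsIn G A w := by simp [hN]
  have hNv : v ∈ neighborsIn G A w := by simp [hN]
  have hNx : x ∈ neighborsIn G A w := by simp [hN]
  have memA {p : V} (hp : p ∈ neighborsIn G A w) : p ∈ A := (mem_neighborsIn.1 hp).1
  by_contra! hno
  have tight {p q : V} (hp : p ∈ neighborsIn G A w) (hq : q ∈ neighborsIn G A w) (hpq : p ≠ q) :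
      ∃ B ⊆ A, p ∈ B ∧ q ∈ B ∧ 4 * B.card ≤ (adjPairs G B).card + 6 := by
    refine hA.exists_tight (memA hp) (memA hq) hpq ?_
    by_cases hadj : G.Adj p q
    exacts [Or.inl hadj, Or.inr (hno p hp q hq hpq hadj)]
  -- A tight set cannot contain all three neighbours: adding `w` would bring 6 ordered pairs, while
  -- the bound grows by only 4.
  have noTriple (B : Finset V) (hB : B ⊆ A) (hu : u ∈ B) (hv : v ∈ B) (hx : x ∈ B) :
      (adjPairs G B).card + 6 < 4 * B.card := by
    have hwB : w ∉ B := fun hwB => hw (hB hwB)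
    have hNB : neighborsIn G B w = {u, v, x} := by
      refine subset_antisymm (fun y hy => ?_) fun y hy => ?_
      · rw [mem_neighborsIn] at hy
        rw [← hN, mem_neighborsIn]
        exact ⟨hB hy.1, hy.2⟩
      · have hy' := hy
        rw [← hN, mem_neighborsIn] at hy'
        rw [mem_neighborsIn]
        refine ⟨?_, hy'.2⟩
        simp only [Finset.mem_insert, Finset.mem_singleton] at hy
        rcases hy with rfl | rfl | rfl <;> assumption
    have h2 : 2 ≤ B.card := by
      rw [← Finset.card_pair huv]
      exact Finset.card_le_card (by simp [Finset.insert_subset_iff, hu, hv])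
    have h1 := h (insert w B) (Finset.insert_subset_insert w hB)
      (by rw [Finset.card_insert_of_notMem hwB]; omega)
    rw [card_adjPairs_insert hwB, hNB, Finset.card_insert_of_notMem hwB,
      Finset.card_eq_three.2 ⟨u, v, x, huv, hux, hvx, rfl⟩] at h1
    omega
  -- If two tight sets share at least two vertices, their union is tight, against `noTriple`.
  have inter {B C : Finset V} (hB : B ⊆ A) (hC : C ⊆ A)
      (htB : 4 * B.card ≤ (adjPairs G B).card + 6) (htC : 4 * C.card ≤ (adjPairs G C).card + 6)
      (hu : u ∈ B ∪ C) (hv : v ∈ B ∪ C) (hx : x ∈ B ∪ C) : (B ∩ C).card ≤ 1 := by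
    by_contra! hcard
    have h1 := noTriple _ (Finset.union_subset hB hC) hu hv hx
    have h2 := card_adjPairs_add_le G B C
    have h3 := hA (B ∩ C) (Finset.inter_subset_left.trans hB) hcard
    have h4 := Finset.card_union_add_card_inter B C
    omega
  obtain ⟨B, hB, huB, hvB, htB⟩ := tight hNu hNv huv
  obtain ⟨C, hC, hvC, hxC, htC⟩ := tight hNv hNx hvx
  obtain ⟨D, hD, huD, hxD, htD⟩ := tight hNu hNx hux
  have hBC := inter hB hC htB htC (by simp [huB]) (by simp [hvB]) (by simp [hxC])
  have hBD := inter hB hD htB htD (by simp [huB]) (by simp [hvB]) (by simp [hxD])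
  have hCD := inter hC hD htC htD (by simp [huD]) (by simp [hvC]) (by simp [hxC])
  -- The three tight sets have disjoint edge sets, and their union has at least 3 vertices fewer
  -- than the sum of their sizes. Adding the three tightness inequalities therefore makes the union
  -- tight, a contradiction.
  have h1 := noTriple (B ∪ C ∪ D) (Finset.union_subset (Finset.union_subset hB hC) hD)
    (by simp [huB]) (by simp [hvB]) (by simp [hxC])
  have h2 : (adjPairs G B).card + (adjPairs G C).card + (adjPairs G D).card ≤
      (adjPairs G (B ∪ C ∪ D)).card := by
    rw [← Finset.card_union_of_disjoint (disjoint_adjPairs hBC), ← Finset.card_union_of_disjoint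
      (Finset.disjoint_union_left.2 ⟨disjoint_adjPairs hBD, disjoint_adjPairs hCD⟩)]
    refine Finset.card_le_card fun p hp => ?_
    simp only [Finset.mem_union, mem_adjPairs] at hp ⊢
    tauto
  have h3 := Finset.card_union_add_card_inter B C
  have h4 := Finset.card_union_add_card_inter (B ∪ C) D
  have h5 : 1 ≤ (B ∩ C).card := Finset.card_pos.2 ⟨v, by simp [hvB, hvC]⟩
  have h6 : 2 ≤ ((B ∪ C) ∩ D).card := by
    rw [← Finset.card_pair hux]
    exact Finset.card_le_card (by simp [Finset.insert_subset_iff, huB, hxC, huD, hxD])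
  omega

end Sparse

/-! ### Induction on the vertices of a sparse graph. -/

section Induction

variable {k K V : Type*} [Field k] [Field K] [Algebra k K] [DecidableEq V]

theorem lineForm_sub_comm {R : Type*} [CommRing R] (u v : Fin 4 → R) :
    lineForm (u - v) = lineForm (v - u) := by
  simp only [lineForm, Pi.sub_apply]
  ring

/-- Extending a configuration of distinct lines by a line with at most three prescribed
coplanarities costs the expected number of parameters, unless there are three prescribed lines that
are pairwise coplanar. -/
theorem exists_card_add_neighborsIn_le {G : SimpleGraph V} {A : Finset V} {w : V}
    {ξ : V → Fin 4 → K} {S : Set K} (hS : ∀ i ∈ A, ∀ j, ξ i j ∈ relAlgClosure k S)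
    (hinj : Set.InjOn ξ A) (hE : ∀ i ∈ A, G.Adj w i → lineForm (ξ w - ξ i) = 0)
    (hdeg : (neighborsIn G A w).card ≤ 3) :
    ∃ T : Finset K, (∀ j, ξ w j ∈ relAlgClosure k (S ∪ T)) ∧
      (T.card + (neighborsIn G A w).card ≤ 4 ∨
        T.card ≤ 2 ∧ (neighborsIn G A w).card = 3 ∧ ∀ u ∈ neighborsIn G A w,
          ∀ v ∈ neighborsIn G A w, lineForm (ξ u - ξ v) = 0) := by
  classical
  have mem {v : V} (hv : v ∈ neighborsIn G A w) :
      (∀ j, ξ v j ∈ relAlgClosure k S) ∧ lineForm (ξ w - ξ v) = 0 :=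
    ⟨hS v (mem_neighborsIn.1 hv).1, hE v (mem_neighborsIn.1 hv).1 (mem_neighborsIn.1 hv).2⟩
  have ne {u v : V} (hu : u ∈ neighborsIn G A w) (hv : v ∈ neighborsIn G A w) (huv : u ≠ v) :
      ξ u ≠ ξ v := fun h => huv (hinj (mem_neighborsIn.1 hu).1 (mem_neighborsIn.1 hv).1 h)
  by_cases h2 : ∃ u ∈ neighborsIn G A w, ∃ v ∈ neighborsIn G A w, u ≠ v
  · obtain ⟨u, hu, v, hv, huv⟩ := h2
    by_cases hall : ∀ u ∈ neighborsIn G A w, ∀ v ∈ neighborsIn G A w, lineForm (ξ u - ξ v) = 0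
    · obtain ⟨T, hT, h⟩ := exists_card_le_two_of_lineForm_eq_zero (mem hu).1 (mem hv).1
        (ne hu hv huv) (mem hu).2 (mem hv).2
      refine ⟨T, h, ?_⟩
      by_cases h3 : (neighborsIn G A w).card = 3
      · exact Or.inr ⟨hT, h3, hall⟩
      · left; omega
    · by_cases h3 : (neighborsIn G A w).card = 3
      · push Not at hall
        obtain ⟨u, hu, v, hv, huv⟩ := hall
        have huv' : u ≠ v := by
          rintro rfl
          simp [lineForm] at huv
        obtain ⟨x, hx, hxuv⟩ : ∃ x ∈ neighborsIn G A w, x ∉ ({u, v} : Finset V) := by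
          refine Finset.exists_mem_notMem_of_card_lt_card ?_
          rw [h3, Finset.card_pair huv']
          omega
        simp only [Finset.mem_insert, Finset.mem_singleton, not_or] at hxuv
        rw [lineForm_sub_comm] at huv
        obtain ⟨T, hT, h⟩ := exists_card_le_one_of_lineForm_eq_zero (mem hu).1 (mem hv).1
          (mem hx).1 huv (ne hu hx (Ne.symm hxuv.1)) (ne hv hx (Ne.symm hxuv.2)) (mem hu).2
          (mem hv).2 (mem hx).2
        exact ⟨T, h, Or.inl (by omega)⟩
      · obtain ⟨T, hT, h⟩ := exists_card_le_two_of_lineForm_eq_zero (mem hu).1 (mem hv).1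
          (ne hu hv huv) (mem hu).2 (mem hv).2
        exact ⟨T, h, Or.inl (by omega)⟩
  · have h1 : (neighborsIn G A w).card ≤ 1 := Finset.card_le_one.2 fun u hu v hv => by
      by_contra huv
      exact h2 ⟨u, hu, v, hv, huv⟩
    rcases (neighborsIn G A w).eq_empty_or_nonempty with h0 | ⟨u, hu⟩
    · refine ⟨Finset.univ.image (ξ w), fun j => subset_relAlgClosure _ (Or.inr (by simp)), ?_⟩
      left
      rw [h0, Finset.card_empty, add_zero]
      exact Finset.card_image_le.trans (by simp)
    · obtain ⟨T, hT, h⟩ := exists_card_le_three_of_lineForm_eq_zero (mem hu).1 (mem hu).2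
      exact ⟨T, h, Or.inl (by omega)⟩

/-- A generic realization of a sparse graph by distinct lines depends on at most
`4 |A| - |E|` parameters. -/
theorem exists_card_add_adjPairs_le {G : SimpleGraph V} {A : Finset V} {ξ : V → Fin 4 → K}
    (hinj : Set.InjOn ξ A)
    (hE : ∀ i ∈ A, ∀ j ∈ A, G.Adj i j → lineForm (ξ i - ξ j) = 0) (hG : IsLamanSparse G A) :
    ∃ T : Finset K, 2 * T.card + (adjPairs G A).card ≤ 8 * A.card ∧
      ∀ i ∈ A, ∀ j, ξ i j ∈ relAlgClosure k (T : Set K) := by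
  classical
  induction hn : A.card generalizing G A with
  | zero =>
    rw [Finset.card_eq_zero] at hn
    subst hn
    exact ⟨∅, by simp [adjPairs], by simp⟩
  | succ n ih =>
    obtain ⟨w, hwA, hdeg⟩ := hG.exists_card_neighborsIn_le (Finset.card_pos.1 (by omega))
    obtain ⟨B, hwB, rfl⟩ : ∃ B, w ∉ B ∧ insert w B = A :=
      ⟨A.erase w, Finset.notMem_erase w A, Finset.insert_erase hwA⟩
    have hB : B.card = n := by
      rw [Finset.card_insert_of_notMem hwB] at hn
      omega
    have hN : neighborsIn G (insert w B) w = neighborsIn G B w := by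
      ext v
      simp only [mem_neighborsIn, Finset.mem_insert]
      constructor
      · rintro ⟨rfl | hv, hadj⟩
        exacts [absurd hadj G.irrefl, ⟨hv, hadj⟩]
      · exact fun h => ⟨Or.inr h.1, h.2⟩
    rw [hN] at hdeg
    have hsub : B ⊆ insert w B := Finset.subset_insert w B
    have hinjB : Set.InjOn ξ B := hinj.mono (by exact_mod_cast hsub)
    have hEB : ∀ i ∈ B, ∀ j ∈ B, G.Adj i j → lineForm (ξ i - ξ j) = 0 :=
      fun i hi j hj => hE i (hsub hi) j (hsub hj)
    have hEw : ∀ i ∈ B, G.Adj w i → lineForm (ξ w - ξ i) = 0 :=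
      fun i hi => hE w (Finset.mem_insert_self w B) i (hsub hi)
    have combine {T T' : Finset K} (hT : ∀ i ∈ B, ∀ j, ξ i j ∈ relAlgClosure k (T : Set K))
        (hT' : ∀ j, ξ w j ∈ relAlgClosure k ((T : Set K) ∪ T')) :
        ∀ i ∈ insert w B, ∀ j, ξ i j ∈ relAlgClosure k ((T ∪ T' : Finset K) : Set K) := by
      rw [Finset.coe_union]
      intro i hi j
      rcases Finset.mem_insert.1 hi with rfl | hi
      exacts [hT' j, relAlgClosure_mono Set.subset_union_left (hT i hi j)]
    rw [card_adjPairs_insert hwB]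
    -- In the exceptional case the induction runs on `G` with a new edge `pq`, which `ξ` already
    -- satisfies. Its two ordered pairs offset the extra parameter of `w`.
    by_cases hspecial : (neighborsIn G B w).card = 3 ∧ ∀ u ∈ neighborsIn G B w,
        ∀ v ∈ neighborsIn G B w, lineForm (ξ u - ξ v) = 0
    · obtain ⟨h3, hall⟩ := hspecial
      obtain ⟨u, v, x, huv, hux, hvx, hNeq⟩ := Finset.card_eq_three.1 h3
      obtain ⟨p, hp, q, hq, hpq, hadj, hsparse⟩ := hG.exists_sup_edge hwB huv hux hvx hNeq
      obtain ⟨T, hTcard, hT⟩ := ih hinjB (fun i hi j hj hij => by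
        rw [SimpleGraph.sup_adj, SimpleGraph.edge_adj] at hij
        rcases hij with hij | ⟨⟨rfl, rfl⟩ | ⟨rfl, rfl⟩, -⟩
        exacts [hEB i hi j hj hij, hall _ hp _ hq, hall _ hq _ hp]) hsparse hB
      have hadd := card_adjPairs_add_two_le hpq hadj (mem_neighborsIn.1 hp).1 (mem_neighborsIn.1 hq).1
      obtain ⟨T', hT', hcard⟩ := exists_card_add_neighborsIn_le hT hinjB hEw hdeg
      refine ⟨T ∪ T', ?_, combine hT hT'⟩
      have := Finset.card_union_le T T'
      omega
    · obtain ⟨T, hTcard, hT⟩ := ih hinjB hEB (hG.mono hsub) hB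
      obtain ⟨T', hT', hcard⟩ := exists_card_add_neighborsIn_le hT hinjB hEw hdeg
      refine ⟨T ∪ T', ?_, combine hT hT'⟩
      have := Finset.card_union_le T T'
      have := hcard.resolve_right fun h => hspecial h.2
      omega

end Induction

/-- The localization of a reduced ring at a minimal prime is a field. Concretely, if no such `g`
existed, the monoid generated by `f` and the complement of `P` would avoid 0, and a prime disjoint
from it would lie strictly inside `P`. -/
theorem Ideal.exists_notMem_mul_eq_zero_of_mem_minimalPrimes {R : Type*} [CommRing R] [IsReduced R]
    {P : Ideal R} (hP : P ∈ minimalPrimes R) {f : R} (hf : f ∈ P) : ∃ g ∉ P, g * f = 0 := by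
  have hPp : P.IsPrime := hP.1.1
  by_contra! h
  have hdisj : Disjoint ((⊥ : Ideal R) : Set R)
      ((P.primeCompl ⊔ Submonoid.powers f : Submonoid R) : Set R) := by
    rw [Set.disjoint_left]
    intro x hx hx'
    obtain ⟨s, hs, _, ⟨n, rfl⟩, hsn⟩ := Submonoid.mem_sup.1 hx'
    have hx0 : s * f ^ n = 0 := hsn.trans hx
    refine h s hs (pow_eq_zero_iff (n := n + 1) (by omega) |>.1 ?_)
    rw [mul_pow, pow_succ, pow_succ]
    linear_combination s ^ n * f * hx0
  obtain ⟨Q, hQ, -, hQd⟩ := Ideal.exists_le_prime_disjoint _ _ hdisj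
  rw [Set.disjoint_left] at hQd
  have hQP : Q ≤ P := fun x hx => by
    by_contra hxP
    exact hQd hx (Submonoid.mem_sup_left (show x ∈ P.primeCompl from hxP))
  exact hQd (hP.2 ⟨hQ, bot_le⟩ hQP hf) (Submonoid.mem_sup_right (Submonoid.mem_powers f))

namespace LineConfig

/-! ### From Laman graphs to sparsity of vertex sets. -/

section Laman

theorem card_adjPairs_univ {V : Type*} [Fintype V] (G : SimpleGraph V) :
    (adjPairs G Finset.univ).card = 2 * G.edgeSet.ncard := by
  classical
  rw [← sum_card_neighborsIn, ← SimpleGraph.coe_edgeFinset, Set.ncard_coe_finset,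
    ← SimpleGraph.sum_degrees_eq_twice_card_edges]
  refine Finset.sum_congr rfl fun w _ => ?_
  rw [← SimpleGraph.card_neighborFinset_eq_degree]
  congr 1
  ext v
  simp [mem_neighborsIn]

theorem IsLaman.isLamanSparse {V : Type*} [Fintype V] {G : SimpleGraph V} (hG : IsLaman G) :
    IsLamanSparse G Finset.univ := by
  intro B _ hB
  have h := hG.2 ((⊤ : G.Subgraph).induce B)
  have heq : adjPairs G B = adjPairs ((⊤ : G.Subgraph).induce (B : Set V)).spanningCoe
      Finset.univ := by
    ext p
    simp [mem_adjPairs]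
    tauto
  have hcard := card_adjPairs_univ ((⊤ : G.Subgraph).induce (B : Set V)).spanningCoe
  rw [← heq, SimpleGraph.Subgraph.edgeSet_spanningCoe] at hcard
  rw [SimpleGraph.Subgraph.induce_verts, Set.ncard_coe_finset] at h
  have := h hB
  omega

end Laman

/-! ### Lines and the coplanarity equation. -/

section Lines

/-- The points at heights 0 and 1 determine the parameters. -/
theorem line_injective : Function.Injective line := by
  intro u v h
  have h0 : (![u 0, u 1, 0] : Fin 3 → ℂ) ∈ line v := by
    rw [← h, mem_line_iff]
    exact ⟨0, by simp⟩
  have h1 : (![u 0, u 1, 0] + (1 : ℂ) • ![u 2, u 3, 1] : Fin 3 → ℂ) ∈ line v := by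
    rw [← h, mem_line_iff]
    exact ⟨1, rfl⟩
  obtain ⟨s, hs⟩ := (mem_line_iff _ _).1 h0
  obtain ⟨t, ht⟩ := (mem_line_iff _ _).1 h1
  have hs0 := congrFun hs 0
  have hs1 := congrFun hs 1
  have hs2 := congrFun hs 2
  have ht0 := congrFun ht 0
  have ht1 := congrFun ht 1
  have ht2 := congrFun ht 2
  simp at hs0 hs1 hs2 ht0 ht1 ht2
  subst hs2 ht2
  simp at hs0 hs1 ht0 ht1
  rw [hs0] at ht0
  rw [hs1] at ht1
  ext i
  fin_cases i
  exacts [hs0, hs1, by simpa using ht0, by simpa using ht1]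

/-- Two non-horizontal lines that meet or are parallel satisfy the coplanarity equation. -/
theorem lineForm_sub_eq_zero {u v : Fin 4 → ℂ}
    (h : (∃ p, p ∈ line u ∧ p ∈ line v) ∨ (line u).Parallel (line v)) :
    lineForm (u - v) = 0 := by
  rcases h with ⟨p, hu, hv⟩ | h
  · obtain ⟨s, hs⟩ := (mem_line_iff _ _).1 hu
    obtain ⟨t, ht⟩ := (mem_line_iff _ _).1 hv
    rw [hs] at ht
    have h0 := congrFun ht 0
    have h1 := congrFun ht 1
    have h2 := congrFun ht 2
    simp at h0 h1 h2
    subst h2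
    simp only [lineForm, Pi.sub_apply]
    linear_combination (u 3 - v 3) * h0 - (u 2 - v 2) * h1
  · have hd := h.direction_eq
    rw [line, line, AffineSubspace.direction_mk', AffineSubspace.direction_mk'] at hd
    have hmem : (![u 2, u 3, 1] : Fin 3 → ℂ) ∈ Submodule.span ℂ {![v 2, v 3, 1]} := by
      rw [← hd]
      exact Submodule.mem_span_singleton_self _
    obtain ⟨t, ht⟩ := Submodule.mem_span_singleton.1 hmem
    have h0 := congrFun ht 0
    have h1 := congrFun ht 1
    have h2 := congrFun ht 2
    simp at h0 h1 h2
    subst h2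
    simp only [lineForm, Pi.sub_apply]
    rw [← h0, ← h1]
    ring

end Lines

theorem vanishingIdeal_zariskiClosure {σ : Type*} (S : Set (σ → ℂ)) :
    MvPolynomial.vanishingIdeal ℂ (zariskiClosure S) = MvPolynomial.vanishingIdeal ℂ S :=
  le_antisymm (MvPolynomial.vanishingIdeal_anti_mono (subset_zariskiClosure S))
    (MvPolynomial.le_vanishingIdeal_zeroLocus _)

theorem isReduced_quotient_vanishingIdeal {σ : Type*} (S : Set (σ → ℂ)) :
    IsReduced (MvPolynomial σ ℂ ⧸ MvPolynomial.vanishingIdeal ℂ S) := by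
  rw [← Ideal.isRadical_iff_quotient_reduced]
  rintro f ⟨n, hn⟩ x hx
  have := hn x hx
  rw [map_pow] at this
  exact eq_zero_of_pow_eq_zero this

/-! ### Upper bound at the generic points of the components. -/

section UpperBound

theorem dimension_realizationVariety_le {n d : ℕ} {G : SimpleGraph (Fin n)}
    (hG : IsLamanSparse G Finset.univ)
    (hd : 8 * n ≤ (adjPairs G Finset.univ).card + 2 * d) :
    dimension (realizationVariety G) ≤ d := by
  rw [dimension, realizationVariety, vanishingIdeal_zariskiClosure]
  set I := MvPolynomial.vanishingIdeal ℂ (realizationSet G) with hI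
  have : IsReduced (MvPolynomial (Fin n × Fin 4) ℂ ⧸ I) := isReduced_quotient_vanishingIdeal _
  refine ringKrullDim_le_of_forall_minimalPrimes (k := ℂ) fun P hPp hP => ?_
  let K := FractionRing ((MvPolynomial (Fin n × Fin 4) ℂ ⧸ I) ⧸ P)
  let q : MvPolynomial (Fin n × Fin 4) ℂ →ₐ[ℂ] ((MvPolynomial (Fin n × Fin 4) ℂ ⧸ I) ⧸ P) :=
    (Ideal.Quotient.mkₐ ℂ P).comp (Ideal.Quotient.mkₐ ℂ I)
  let ψ : MvPolynomial (Fin n × Fin 4) ℂ →ₐ[ℂ] K :=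
    (IsScalarTower.toAlgHom ℂ ((MvPolynomial (Fin n × Fin 4) ℂ ⧸ I) ⧸ P) K).comp q
  have hψI (f) (hf : f ∈ I) : ψ f = 0 := by
    have : Ideal.Quotient.mk I f = 0 := Ideal.Quotient.eq_zero_iff_mem.2 hf
    simp [ψ, q, this]
  have hψP (f) (hf : ψ f = 0) : Ideal.Quotient.mk I f ∈ P :=
    Ideal.Quotient.eq_zero_iff_mem.1
      ((IsFractionRing.injective _ K) (hf.trans (map_zero (algebraMap _ K)).symm))
  let X (i : Fin n) (j : Fin 4) : MvPolynomial (Fin n × Fin 4) ℂ := MvPolynomial.X (i, j)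
  let ξ (i : Fin n) (j : Fin 4) : K := ψ (X i j)
  -- Distinctness survives at the generic point. If ξᵢ = ξᵢ', each of the four coordinate
  -- differences is killed by some gⱼ outside `P`. At every realization some difference is nonzero,
  -- so the product of the gⱼ vanishes there; it is then zero in the coordinate ring and lies in
  -- `P`.
  have hinj : Function.Injective ξ := by
    intro i i' hii
    by_contra hne
    have hg (j : Fin 4) : ∃ g ∉ P, g * Ideal.Quotient.mk I (X i j - X i' j) = 0 := by
      refine Ideal.exists_notMem_mul_eq_zero_of_mem_minimalPrimes hP (hψP _ ?_)
      rw [map_sub]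
      exact sub_eq_zero.2 (congrFun hii j)
    choose g hgP hg using hg
    have hprod : ∏ j, g j ∉ P := fun h => by
      obtain ⟨j, -, hj⟩ := hPp.prod_mem_iff.1 h
      exact hgP j hj
    choose g' hg' using fun j => Ideal.Quotient.mk_surjective (I := I) (g j)
    refine hprod ?_
    have hzero : Ideal.Quotient.mk I (∏ j, g' j) = 0 := by
      refine Ideal.Quotient.eq_zero_iff_mem.2 fun x hx => ?_
      have hxne : ∃ j, x (i, j) ≠ x (i', j) := by
        by_contra! hall
        refine hne (hx.2 ?_)
        simp only [lines]
        congr 1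
        ext j
        exact hall j
      obtain ⟨j, hj⟩ := hxne
      have hmem : g' j * (X i j - X i' j) ∈ I := by
        rw [← Ideal.Quotient.eq_zero_iff_mem, map_mul, hg']
        exact hg j
      have hev := hmem x hx
      simp only [map_mul, map_sub, X, MvPolynomial.aeval_X] at hev
      rw [map_prod]
      exact Finset.prod_eq_zero (Finset.mem_univ j)
        ((mul_eq_zero.1 hev).resolve_right (sub_ne_zero.2 hj))
    rw [map_prod] at hzero
    simp only [hg'] at hzero
    rw [hzero]
    exact zero_mem P
  have hE (i j : Fin n) (hij : G.Adj i j) : lineForm (ξ i - ξ j) = 0 := by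
    have hmem : lineForm (X i - X j) ∈ I := fun x hx => by
      have := lineForm_sub_eq_zero (hx.1 hij).2
      simpa [lineForm, X] using this
    have := hψI _ hmem
    simpa [lineForm, ξ] using this
  obtain ⟨T, hT, hξ⟩ := exists_card_add_adjPairs_le (k := ℂ) hinj.injOn (fun i _ j _ => hE i j) hG
  have hψmem (f) : ψ f ∈ relAlgClosure ℂ (T : Set K) := by
    induction f using MvPolynomial.induction_on with
    | C a =>
      have : ψ (MvPolynomial.C a) = algebraMap ℂ K a := ψ.commutes a
      rw [this]
      exact IntermediateField.algebraMap_mem _ a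
    | add f g hf hg => rw [map_add]; exact add_mem hf hg
    | mul_X f i hf => rw [map_mul]; exact mul_mem hf (hξ i.1 (Finset.mem_univ _) i.2)
  have htop : relAlgClosure ℂ (T : Set K) = ⊤ := by
    refine eq_top_iff.2 fun x _ => ?_
    obtain ⟨a, b, -, rfl⟩ := IsFractionRing.div_surjective
      (A := (MvPolynomial (Fin n × Fin 4) ℂ ⧸ I) ⧸ P) x
    have hq : Function.Surjective q :=
      (Ideal.Quotient.mkₐ_surjective ℂ P).comp (Ideal.Quotient.mkₐ_surjective ℂ I)
    obtain ⟨a, rfl⟩ := hq a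
    obtain ⟨b, rfl⟩ := hq b
    exact div_mem (hψmem a) (hψmem b)
  refine (trdeg_le_card_of_relAlgClosure_eq_top htop).trans ?_
  rw [Finset.card_univ, Fintype.card_fin] at hT
  exact_mod_cast (by omega : T.card ≤ d)

end UpperBound

end LineConfig

namespace LineConfig

/-! ### Lower bound from concurrent lines. -/

section LowerBound

/-- The coordinates of `n` lines through the point `(p₀, p₁, p₂)` with the directions
`(cᵢ, dᵢ, 1)`. -/
noncomputable def concurrentLines {R : Type*} [CommRing R] {n : ℕ} (t : Fin 3 ⊕ Fin n × Fin 2 → R)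
    (i : Fin n × Fin 4) : R :=
  ![t (.inl 0) - t (.inl 2) * t (.inr (i.1, 0)), t (.inl 1) - t (.inl 2) * t (.inr (i.1, 1)),
    t (.inr (i.1, 0)), t (.inr (i.1, 1))] i.2

theorem map_concurrentLines {R S : Type*} [CommRing R] [CommRing S] (f : R →+* S) {n : ℕ}
    (t : Fin 3 ⊕ Fin n × Fin 2 → R) (i : Fin n × Fin 4) :
    f (concurrentLines t i) = concurrentLines (fun j => f (t j)) i := by
  obtain ⟨i, k⟩ := i
  fin_cases k <;> simp [concurrentLines]

theorem concurrentLines_mem_realizationSet {n : ℕ} (G : SimpleGraph (Fin n))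
    {t : Fin 3 ⊕ Fin n × Fin 2 → ℂ} (ht : Function.Injective fun i => t (.inr (i, 0))) :
    concurrentLines t ∈ realizationSet G := by
  have hmem (i : Fin n) : ![t (.inl 0), t (.inl 1), t (.inl 2)] ∈ lines (concurrentLines t) i := by
    rw [lines, mem_line_iff]
    refine ⟨t (.inl 2), ?_⟩
    ext k
    fin_cases k <;> simp [concurrentLines]
  refine ⟨fun i j hij => ⟨hij.ne, Or.inl ⟨_, hmem i, hmem j⟩⟩, fun i j hij => ht ?_⟩
  exact congrFun (line_injective hij) 2

/-- The parametrization of the concurrent `n`-tuples of lines, on the level of coordinate rings. -/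
noncomputable def concurrentHom (n : ℕ) :
    MvPolynomial (Fin n × Fin 4) ℂ →ₐ[ℂ] MvPolynomial (Fin 3 ⊕ Fin n × Fin 2) ℂ :=
  MvPolynomial.aeval (concurrentLines MvPolynomial.X)

theorem eval_concurrentHom {n : ℕ} (t : Fin 3 ⊕ Fin n × Fin 2 → ℂ)
    (f : MvPolynomial (Fin n × Fin 4) ℂ) :
    MvPolynomial.eval t (concurrentHom n f) = MvPolynomial.aeval (concurrentLines t) f := by
  have : (MvPolynomial.aeval t).comp (concurrentHom n) =
      (MvPolynomial.aeval (concurrentLines t) : _ →ₐ[ℂ] ℂ) := by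
    ext i
    simpa [concurrentHom] using map_concurrentLines (MvPolynomial.eval t) MvPolynomial.X i
  exact DFunLike.congr_fun this f

/-- Concurrent tuples with distinct first direction coordinates are realizations and form a dense
set. Multiplying by the discriminant-like `Δ` gives a polynomial that vanishes everywhere. -/
theorem concurrentHom_eq_zero {n : ℕ} {G : SimpleGraph (Fin n)} {f : MvPolynomial (Fin n × Fin 4) ℂ}
    (hf : f ∈ MvPolynomial.vanishingIdeal ℂ (realizationSet G)) : concurrentHom n f = 0 := by
  let Δ : MvPolynomial (Fin 3 ⊕ Fin n × Fin 2) ℂ := ∏ i : Fin n, ∏ j ∈ Finset.univ.erase i,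
    (MvPolynomial.X (.inr (i, 0)) - MvPolynomial.X (.inr (j, 0)))
  have hΔ : Δ ≠ 0 := by
    refine Finset.prod_ne_zero_iff.2 fun i _ => Finset.prod_ne_zero_iff.2 fun j hj => ?_
    refine sub_ne_zero.2 fun h => Finset.ne_of_mem_erase hj ?_
    simpa using (MvPolynomial.X_injective h).symm
  refine (mul_eq_zero.1 (?_ : concurrentHom n f * Δ = 0)).resolve_right hΔ
  refine MvPolynomial.funext fun t => ?_
  rw [map_mul, eval_concurrentHom, map_zero]
  by_cases ht : Function.Injective fun i => t (.inr (i, 0))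
  · rw [hf _ (concurrentLines_mem_realizationSet G ht), zero_mul]
  · simp only [Function.Injective, not_forall] at ht
    obtain ⟨i, j, hij, hne⟩ := ht
    refine mul_eq_zero_of_right _ ?_
    rw [map_prod]
    refine Finset.prod_eq_zero (Finset.mem_univ i) ?_
    rw [map_prod]
    refine Finset.prod_eq_zero (Finset.mem_erase.2 ⟨Ne.symm hne, Finset.mem_univ j⟩) ?_
    simpa [sub_eq_zero] using hij

/-- The directions are themselves coordinates. Two lines are needed to recover the point: a₀ - a₁ =
p₂(c₁ - c₀) gives its height p₂, and then p₀ and p₁ follow from the first line. -/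
theorem isAlgebraic_range_concurrentHom {n : ℕ} (hn : 2 ≤ n) :
    Algebra.IsAlgebraic (concurrentHom n).range (MvPolynomial (Fin 3 ⊕ Fin n × Fin 2) ℂ) := by
  have coord (i) : IsAlgebraic (concurrentHom n).range
      (concurrentLines (MvPolynomial.X : _ → MvPolynomial (Fin 3 ⊕ Fin n × Fin 2) ℂ) i) :=
    isAlgebraic_algebraMap (⟨_, MvPolynomial.X i, MvPolynomial.aeval_X _ i⟩ : (concurrentHom n).range)
  let Y : Fin 3 ⊕ Fin n × Fin 2 → MvPolynomial (Fin 3 ⊕ Fin n × Fin 2) ℂ := MvPolynomial.X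
  have hr (i : Fin n) (k : Fin 2) : IsAlgebraic (concurrentHom n).range (Y (.inr (i, k))) := by
    fin_cases k
    exacts [coord (i, 2), coord (i, 3)]
  let i₀ : Fin n := ⟨0, by omega⟩
  let i₁ : Fin n := ⟨1, by omega⟩
  have h2 : IsAlgebraic (concurrentHom n).range (Y (.inl 2)) := by
    refine IsAlgebraic.of_mul (y := Y (.inr (i₁, 0)) - Y (.inr (i₀, 0)))
      (mem_nonZeroDivisors_of_ne_zero (sub_ne_zero.2 fun h => ?_)) ((hr _ _).sub (hr _ _)) ?_
    · have := MvPolynomial.X_injective h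
      simp [i₀, i₁] at this
    · have := (coord (i₀, 0)).sub (coord (i₁, 0))
      convert this using 1
      simp only [concurrentLines, Y, Matrix.cons_val_zero]
      ring
  have h0 : IsAlgebraic (concurrentHom n).range (Y (.inl 0)) := by
    have h : concurrentLines Y (i₀, 0) + Y (.inl 2) * Y (.inr (i₀, 0)) = Y (.inl 0) := by
      simp [concurrentLines]
    exact h ▸ (coord (i₀, 0)).add (h2.mul (hr i₀ 0))
  have h1 : IsAlgebraic (concurrentHom n).range (Y (.inl 1)) := by
    have h : concurrentLines Y (i₀, 1) + Y (.inl 2) * Y (.inr (i₀, 1)) = Y (.inl 1) := by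
      simp [concurrentLines]
    exact h ▸ (coord (i₀, 1)).add (h2.mul (hr i₀ 1))
  refine ⟨fun f => ?_⟩
  induction f using MvPolynomial.induction_on with
  | C a => exact isAlgebraic_algebraMap (algebraMap ℂ (concurrentHom n).range a)
  | add f g hf hg => exact hf.add hg
  | mul_X f i hf =>
    refine hf.mul ?_
    rcases i with i | ⟨i, k⟩
    · fin_cases i
      exacts [h0, h1, h2]
    · exact hr i k

theorem le_dimension_realizationVariety {n : ℕ} (hn : 2 ≤ n) (G : SimpleGraph (Fin n)) :
    ((2 * n + 3 : ℕ) : WithBot ℕ∞) ≤ dimension (realizationVariety G) := by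
  rw [dimension, realizationVariety, vanishingIdeal_zariskiClosure]
  have := isAlgebraic_range_concurrentHom hn
  have : Algebra.FiniteType ℂ (concurrentHom n).range :=
    .of_surjective _ (concurrentHom n).rangeRestrict_surjective
  have htr : ((2 * n + 3 : ℕ) : Cardinal) ≤
      Algebra.trdeg ℂ (MvPolynomial (Fin 3 ⊕ Fin n × Fin 2) ℂ) := by
    rw [MvPolynomial.trdeg_of_isDomain, Cardinal.mk_fintype, Cardinal.lift_natCast, Nat.cast_le]
    simp
    omega
  refine (natCast_le_ringKrullDim_of_le_trdeg (B := (concurrentHom n).range) htr).trans ?_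
  -- The coordinate ring of the variety surjects onto that of the closure of the concurrent tuples.
  refine ringKrullDim_le_of_surjective (Ideal.Quotient.lift _
    (concurrentHom n).rangeRestrict.toRingHom fun f hf => Subtype.ext (concurrentHom_eq_zero hf)) ?_
  exact Ideal.Quotient.lift_surjective_of_surjective _ _
    (concurrentHom n).rangeRestrict_surjective

end LowerBound

end LineConfig

theorem mainTheorem1 (n : ℕ) (G : SimpleGraph (Fin n)) (hG : LineConfig.IsLaman G) :
    LineConfig.dimension (LineConfig.realizationVariety G) = ((2 * n + 3 : ℕ) : WithBot ℕ∞) := by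
  have hcard := hG.1
  rw [Fintype.card_fin] at hcard
  have hpairs := LineConfig.card_adjPairs_univ G
  -- The edge count gives 8n = 2(2n - 3) + 2(2n + 3), and 2n - 3 ≥ 0 forces n ≥ 2.
  exact le_antisymm
    (LineConfig.dimension_realizationVariety_le hG.isLamanSparse (by omega))
    (LineConfig.le_dimension_realizationVariety (by omega) G)
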